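/- Let $\mathcal S^{n\times n}$ be the space of real symmetric $n\times n$ matrices with the Frobenius inner product, let $\mathcal O(n)\subset\mathbb R^{n\times n}$ be the set of orthogonal matrices, regarded as a Riemannian submanifold of $\mathbb R^{n\times n}$ with the Frobenius inner product, and let $F:\mathcal S^{n\times n}\to\mathbb R$ be differentiable with $$\|\nabla F(X_1)-\nabla F(X_2)\|_F\le L_F\|X_1-X_2\|_F\qquad\text{for all }X_1,X_2\in\mathcal S^{n\times n},$$ where $L_F>0$. Put $f(U,\lambda)=F(U\,\mathrm{Diag}(\lambda)\,U^\top)$ for $U\in\mathbb R^{n\times n}$, $\lambda\in\mathbb R^n$, and let $\mathcal C\subset\mathbb R^n$ satisfy $\|\lambda\|\le D$ for all $\lambda\in\mathcal C$. Let $\mathrm{Exp}$ be the Riemannian exponential map of $\mathcal O(n)$. A retraction on $\mathcal O(n)$ is a smooth map $R:T\mathcal O(n)\to\mathcal O(n)$ such that, for all $Q\in\mathcal O(n)$ and $V\in T_Q\mathcal O(n)$, the curve $t\mapsto R(Q,tV)$ starts at $Q$ with velocity $V$. 1. For every retraction $R$ on $\mathcal O(n)$ the restriction of $f$ to $\mathcal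 O(n)\times\mathcal C$ satisfies the following Lipschitz conditions, where $\nabla_\lambda f$ exists on $\mathcal O(n)\times\mathcal C$: (a) there is $L_\lambda\ge 0$ with $\|\nabla_\lambda f(Q,\lambda_1)-\nabla_\lambda f(Q,\lambda_2)\|\le L_\lambda\|\lambda_1-\lambda_2\|$ for all $Q\in\mathcal O(n)$, $\lambda_1,\lambda_2\in\mathcal C$; (b) there is $L_Q\ge 1$ such that for every $\lambda\in\mathcal C$ the function $f(\cdot,\lambda):\mathcal O(n)\to\mathbb R$ has a Riemannian gradient $\operatorname{grad} f(\cdot,\lambda)$ and, both for $\mathcal R=\mathrm{Exp}$ and for $\mathcal R=R$, $$f(\mathcal R(Q,V),\lambda)\le f(Q,\lambda)+\langle\operatorname{grad} f(Q,\lambda),V\rangle+\tfrac{L_Q}{2}\|V\|_F^2\qquad\text{for all }Q\in\mathcal O(n),\ V\in T_Q\mathcal O(n);$$ (c) there is $L_{Q\lambda}\ge 0$ with $\|\nabla_\lambda f(Q_1,\lambda)-\nabla_\lambda f(Q_2,\lambda)\|\le L_{Q\lambda}\|Q_1-Q_2\|_F$ for all $Q_1,Q_2\in\mathcal O(n)$,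 $\lambda\in\mathcal C$. 2. For every $Q\in\mathcal O(n)$ the function $f(Q,\cdot)$ is differentiable on $\mathbb R^n$, and $\|\nabla_\lambda f(Q,\lambda_1)-\nabla_\lambda f(Q,\lambda_2)\|\le\sqrt n\,L_F\|\lambda_1-\lambda_2\|$ for all $\lambda_1,\lambda_2\in\mathbb R^n$. 3. There is $L_G\ge 0$ such that for every $\lambda\in\mathcal C$ the function $G_\lambda=f(\cdot,\lambda)$ is differentiable on $\mathbb R^{n\times n}$ and $\|\nabla G_\lambda(U)-\nabla G_\lambda(V)\|_F\le L_G\|U-V\|_F$ for all $U,V$ in the convex hull of $\mathcal O(n)$. -/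

import Mathlib

open Set Filter Topology
open scoped ContDiff Gradient

attribute [local instance] Matrix.frobeniusNormedAddCommGroup Matrix.frobeniusNormedSpace

namespace SpectralLip

section Submanifold

/-! ### Subsets of a Euclidean space as Riemannian submanifolds

Everything is stated for a subset `M` of a Euclidean space `E`; it is meant for the case that `M` is
an embedded submanifold carrying the metric of `E`. Maps on `M` or on its tangent bundle are
represented by total maps; only their values on `M`, resp. on the tangent bundle, are used. -/

variable {E : Type*} [NormedAddCommGroup E] [InnerProductSpace ℝ E]

/-- `c` is a curve on `M` through `x` at time `0` that is smooth around `0`. -/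
def IsSmoothCurveAt (M : Set E) (x : E) (c : ℝ → E) : Prop :=
  c 0 = x ∧ ∃ ε > 0, ContDiffOn ℝ ∞ c (Ioo (-ε) ε) ∧ ∀ t ∈ Ioo (-ε) ε, c t ∈ M

/-- The tangent space `T_x M`: velocities at `0` of the smooth curves on `M` through `x`. -/
def tangentSpaceAt (M : Set E) (x : E) : Set E :=
  {v | ∃ c : ℝ → E, IsSmoothCurveAt M x c ∧ HasDerivAt c v 0}

/-- The tangent bundle `TM`, as a subset of `E × E`. -/
def tangentBundle (M : Set E) : Set (E × E) :=
  {p | p.1 ∈ M ∧ p.2 ∈ tangentSpaceAt M p.1}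

/-- `R : TM → M` is a retraction: it is smooth (near each point of `TM` it agrees on `TM` with a
smooth map on an open subset of the ambient space), and each curve `t ↦ R x (t v)` starts at `x`
with velocity `v`. -/
structure IsRetraction (M : Set E) (R : E → E → E) : Prop where
  mapsTo : ∀ x ∈ M, ∀ v ∈ tangentSpaceAt M x, R x v ∈ M
  smooth : ∀ p ∈ tangentBundle M, ∃ U : Set (E × E), IsOpen U ∧ p ∈ U ∧
    ∃ Rbar : E × E → E, ContDiffOn ℝ ∞ Rbar U ∧
      ∀ q ∈ U ∩ tangentBundle M, Rbar q = R q.1 q.2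
  zero : ∀ x ∈ M, R x 0 = x
  deriv_zero : ∀ x ∈ M, ∀ v ∈ tangentSpaceAt M x, HasDerivAt (fun t : ℝ => R x (t • v)) v 0

/-- `g` is the Riemannian gradient of `h : M → ℝ` at `x`: the tangent vector that represents the
differential of `h`, which is computed along smooth curves on `M`. -/
def IsRiemannianGradient (M : Set E) (h : E → ℝ) (x g : E) : Prop :=
  g ∈ tangentSpaceAt M x ∧
    ∀ (c : ℝ → E) (v : E), IsSmoothCurveAt M x c → HasDerivAt c v 0 →
      HasDerivAt (fun t => h (c t)) (inner ℝ v g) 0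

/-- `h : M → ℝ` has a gradient Lipschitz retraction with constant `L` with respect to `R`; the
existence of the Riemannian gradient of `h` is part of the condition. -/
def HasGradLipRetraction (M : Set E) (R : E → E → E) (h : E → ℝ) (L : ℝ) : Prop :=
  ∀ x ∈ M, ∃ g, IsRiemannianGradient M h x g ∧
    ∀ v ∈ tangentSpaceAt M x, h (R x v) ≤ h x + inner ℝ g v + L / 2 * ‖v‖ ^ 2

/-- `γ` is a geodesic of the Riemannian submanifold `M` defined for all times: a smooth curve on `M`
whose acceleration in `E` is everywhere orthogonal to `M`. -/
structure IsGeodesic (M : Set E) (γ : ℝ → E) : Prop where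
  smooth : ContDiff ℝ ∞ γ
  mem : ∀ t, γ t ∈ M
  normal : ∀ t, ∀ w ∈ tangentSpaceAt M (γ t), inner ℝ (deriv (deriv γ) t) w = 0

/-- `γ` is a geodesic with initial position `x` and initial velocity `v`. -/
def IsGeodesicFrom (M : Set E) (x v : E) (γ : ℝ → E) : Prop :=
  IsGeodesic M γ ∧ γ 0 = x ∧ deriv γ 0 = v

open Classical in
/-- The Riemannian exponential map of a geodesically complete submanifold: `Exp x v = γ 1` for the
geodesic `γ` with `γ 0 = x` and `γ' 0 = v` (and `x` where there is none; for the orthogonal group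
see `exists_geodesic` and `geodesic_unique` below). -/
noncomputable def riemannianExp (M : Set E) (x v : E) : E :=
  if h : ∃ γ : ℝ → E, IsGeodesicFrom M x v γ then h.choose 1 else x

/-- The Lipschitz conditions on `f : M × C → ℝ`, where `C` is a set of parameters `y` and `R` is the
retraction in use. Gradients in `y` are those of `f x` on the whole space `Y`. -/
structure LipschitzConditions {Y : Type*} [NormedAddCommGroup Y] [InnerProductSpace ℝ Y]
    [CompleteSpace Y] (M : Set E) (C : Set Y) (R : E → E → E) (f : E → Y → ℝ) : Prop where
  differentiable : ∀ x ∈ M, ∀ y ∈ C, DifferentiableAt ℝ (f x) y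
  grad_y : ∃ Ly : ℝ, 0 ≤ Ly ∧ ∀ x ∈ M, ∀ y₁ ∈ C, ∀ y₂ ∈ C,
    ‖∇ (f x) y₁ - ∇ (f x) y₂‖ ≤ Ly * ‖y₁ - y₂‖
  grad_x : ∃ Lx : ℝ, 1 ≤ Lx ∧ ∀ y ∈ C,
    HasGradLipRetraction M (riemannianExp M) (fun x => f x y) Lx ∧
    HasGradLipRetraction M R (fun x => f x y) Lx
  grad_xy : ∃ Lxy : ℝ, 0 ≤ Lxy ∧ ∀ x₁ ∈ M, ∀ x₂ ∈ M, ∀ y ∈ C,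
    ‖∇ (f x₁) y - ∇ (f x₂) y‖ ≤ Lxy * ‖x₁ - x₂‖

end Submanifold

section Matrices

/-- The Frobenius inner product `⟨A, B⟩ = tr (Aᵀ B)`, which induces the Frobenius norm. -/
noncomputable instance frobeniusInnerProductSpace (n : ℕ) :
    InnerProductSpace ℝ (Matrix (Fin n) (Fin n) ℝ) where
  inner A B := (A.transpose * B).trace
  norm_sq_eq_re_inner A := by
    have h : 0 ≤ ∑ i, ∑ j, ‖A i j‖ ^ (2 : ℝ) := by positivity
    rw [Matrix.frobenius_norm_def, ← Real.sqrt_eq_rpow, Real.sq_sqrt h]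
    simp only [Matrix.trace, Matrix.diag, Matrix.mul_apply, Matrix.transpose_apply,
      RCLike.re_to_real]
    rw [Finset.sum_comm]
    refine Finset.sum_congr rfl fun i _ => Finset.sum_congr rfl fun j _ => ?_
    rw [Real.rpow_two, Real.norm_eq_abs, sq_abs, sq]
  conj_inner_symm A B := by
    rw [conj_trivial, ← Matrix.trace_transpose, Matrix.transpose_mul, Matrix.transpose_transpose]
  add_left A B C := by
    simp [Matrix.add_mul]
  smul_left A B r := by
    simp

/-- The space of real symmetric `n × n` matrices, with the Frobenius inner product. -/
def symMatrix (n : ℕ) : Submodule ℝ (Matrix (Fin n) (Fin n) ℝ) where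
  carrier := {A | A.IsSymm}
  add_mem' hA hB := hA.add hB
  zero_mem' := Matrix.isSymm_zero
  smul_mem' r _ hA := hA.smul r

/-- The manifold of orthogonal `n × n` matrices. -/
def orthogonalMatrices (n : ℕ) : Set (Matrix (Fin n) (Fin n) ℝ) :=
  (Matrix.orthogonalGroup (Fin n) ℝ : Set (Matrix (Fin n) (Fin n) ℝ))

/-- The symmetric matrix `U Diag(l) Uᵀ`. -/
def conjDiag {n : ℕ} (U : Matrix (Fin n) (Fin n) ℝ) (l : EuclideanSpace ℝ (Fin n)) :
    symMatrix n :=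
  ⟨U * Matrix.diagonal (fun i => l i) * U.transpose, by
    simp [symMatrix, Matrix.IsSymm, Matrix.mul_assoc]⟩

/-- `f(U, l) = F(U Diag(l) Uᵀ)`; the formula makes sense for every square matrix `U`. -/
def spectralObjective {n : ℕ} (F : symMatrix n → ℝ) (U : Matrix (Fin n) (Fin n) ℝ)
    (l : EuclideanSpace ℝ (Fin n)) : ℝ :=
  F (conjDiag U l)

end Matrices

section Geodesics

/-! ### The exponential map of the orthogonal group is well defined -/

attribute [local instance] Matrix.frobeniusNormedRing Matrix.frobeniusNormedAlgebra

open Matrix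

variable {n : ℕ}

theorem inner_eq_trace (A B : Matrix (Fin n) (Fin n) ℝ) : inner ℝ A B = (Aᵀ * B).trace := rfl

theorem hasDerivAt_transpose {c : ℝ → Matrix (Fin n) (Fin n) ℝ} {v : Matrix (Fin n) (Fin n) ℝ}
    {t : ℝ} (h : HasDerivAt c v t) : HasDerivAt (fun s => (c s)ᵀ) vᵀ t :=
  (LinearMap.toContinuousLinearMap
    (Matrix.transposeLinearEquiv (Fin n) (Fin n) ℝ ℝ).toLinearMap).hasFDerivAt.comp_hasDerivAt t h

theorem mem_orthogonalMatrices {Q : Matrix (Fin n) (Fin n) ℝ} :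
    Q ∈ orthogonalMatrices n ↔ Qᵀ * Q = 1 :=
  Matrix.mem_orthogonalGroup_iff' (Fin n) ℝ

theorem mul_transpose_of_mem {Q : Matrix (Fin n) (Fin n) ℝ} (hQ : Q ∈ orthogonalMatrices n) :
    Q * Qᵀ = 1 :=
  (Matrix.mem_orthogonalGroup_iff (Fin n) ℝ).1 hQ

theorem transpose_mul_skew {Q v : Matrix (Fin n) (Fin n) ℝ}
    (hv : v ∈ tangentSpaceAt (orthogonalMatrices n) Q) : (Qᵀ * v)ᵀ = -(Qᵀ * v) := by
  obtain ⟨c, ⟨h0, ε, hε, -, hc⟩, hd⟩ := hv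
  have h1 := (hasDerivAt_transpose hd).mul hd
  have h2 : (fun t => (c t)ᵀ * c t) =ᶠ[𝓝 0] fun _ => 1 := by
    filter_upwards [Ioo_mem_nhds (neg_lt_zero.2 hε) hε] with t ht
    exact mem_orthogonalMatrices.1 (hc t ht)
  have h3 := h1.unique ((hasDerivAt_const (0 : ℝ)
    (1 : Matrix (Fin n) (Fin n) ℝ)).congr_of_eventuallyEq h2)
  rw [h0] at h3
  rw [Matrix.transpose_mul, Matrix.transpose_transpose]
  exact eq_neg_of_add_eq_zero_left h3

theorem exp_skew_mem {A : Matrix (Fin n) (Fin n) ℝ} (hA : Aᵀ = -A) (t : ℝ) :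
    NormedSpace.exp (t • A) ∈ orthogonalMatrices n := by
  rw [mem_orthogonalMatrices, ← Matrix.exp_transpose, Matrix.transpose_smul, hA, smul_neg,
    ← Matrix.exp_add_of_commute _ _ ((Commute.refl (t • A)).neg_left), neg_add_cancel,
    NormedSpace.exp_zero]

theorem mul_mem_orthogonal {P Q : Matrix (Fin n) (Fin n) ℝ} (hP : P ∈ orthogonalMatrices n)
    (hQ : Q ∈ orthogonalMatrices n) : P * Q ∈ orthogonalMatrices n :=
  (Matrix.orthogonalGroup (Fin n) ℝ).mul_mem hP hQ

theorem hasDerivAt_mul_exp (Q A : Matrix (Fin n) (Fin n) ℝ) (t : ℝ) :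
    HasDerivAt (fun s : ℝ => Q * NormedSpace.exp (s • A)) (Q * NormedSpace.exp (t • A) * A) t := by
  have h := (hasDerivAt_exp_smul_const (𝕂 := ℝ) A t).const_mul Q
  rwa [← mul_assoc] at h

theorem contDiff_mul_exp (Q A : Matrix (Fin n) (Fin n) ℝ) :
    ContDiff ℝ ∞ (fun s : ℝ => Q * NormedSpace.exp (s • A)) := by
  have h : ContDiff ℝ ∞ (NormedSpace.exp : Matrix (Fin n) (Fin n) ℝ → _) :=
    contDiff_iff_contDiffAt.2 fun x => (NormedSpace.exp_analytic (𝕂 := ℝ) x).contDiffAt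
  exact contDiff_const.mul (h.comp (contDiff_id.smul contDiff_const))

theorem mul_skew_mem_tangent {Q A : Matrix (Fin n) (Fin n) ℝ} (hQ : Q ∈ orthogonalMatrices n)
    (hA : Aᵀ = -A) : Q * A ∈ tangentSpaceAt (orthogonalMatrices n) Q := by
  refine ⟨fun s => Q * NormedSpace.exp (s • A), ⟨by simp, 1, one_pos,
    (contDiff_mul_exp Q A).contDiffOn, fun t _ => mul_mem_orthogonal hQ (exp_skew_mem hA t)⟩, ?_⟩
  have h := hasDerivAt_mul_exp Q A 0
  rw [zero_smul, NormedSpace.exp_zero, mul_one] at h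
  exact h

theorem exists_geodesic {Q v : Matrix (Fin n) (Fin n) ℝ} (hQ : Q ∈ orthogonalMatrices n)
    (hv : v ∈ tangentSpaceAt (orthogonalMatrices n) Q) :
    ∃ γ, IsGeodesicFrom (orthogonalMatrices n) Q v γ := by
  have hA := transpose_mul_skew hv
  set A := Qᵀ * v with hAdef
  have hd : deriv (fun s : ℝ => Q * NormedSpace.exp (s • A)) =
      fun t => Q * NormedSpace.exp (t • A) * A := funext fun t => (hasDerivAt_mul_exp Q A t).deriv
  have hdd : ∀ t, deriv (deriv (fun s : ℝ => Q * NormedSpace.exp (s • A))) t =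
      Q * NormedSpace.exp (t • A) * A * A := fun t => by
    rw [hd]
    exact ((hasDerivAt_mul_exp Q A t).mul_const A).deriv
  have hd0 : deriv (fun s : ℝ => Q * NormedSpace.exp (s • A)) 0 = v := by
    rw [hd]
    simp [hAdef, ← Matrix.mul_assoc, mul_transpose_of_mem hQ]
  refine ⟨fun s => Q * NormedSpace.exp (s • A), ⟨contDiff_mul_exp Q A,
    fun t => mul_mem_orthogonal hQ (exp_skew_mem hA t), fun t w hw => ?_⟩, by simp, hd0⟩
  · have hB := transpose_mul_skew hw
    refine Eq.trans (congrArg (fun X => inner ℝ X w) (hdd t)) ?_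
    rw [inner_eq_trace]
    set P := Q * NormedSpace.exp (t • A)
    set B := Pᵀ * w with hBdef
    have h1 : (P * A * A)ᵀ * w = A * A * B := by
      simp [Matrix.transpose_mul, hA, Matrix.mul_assoc, hBdef]
    have h2 : (A * A * B).trace = -(A * A * B).trace := by
      conv_lhs => rw [← Matrix.trace_transpose]
      rw [Matrix.transpose_mul (A * A) B, Matrix.transpose_mul A A, hA, hB,
        Matrix.trace_mul_comm (A * A) B]
      simp
    rw [h1]
    linarith

theorem isSymm_of_trace_skew {S : Matrix (Fin n) (Fin n) ℝ}
    (h : ∀ B : Matrix (Fin n) (Fin n) ℝ, Bᵀ = -B → (Sᵀ * B).trace = 0) : Sᵀ = S := by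
  have h1 := h (S - Sᵀ) (by simp)
  have h2 : (S * (S - Sᵀ)).trace = -(Sᵀ * (S - Sᵀ)).trace := by
    rw [← Matrix.trace_transpose, Matrix.transpose_mul, Matrix.trace_mul_comm,
      ← Matrix.trace_neg, ← Matrix.mul_neg]
    simp
  have h3 : inner ℝ (S - Sᵀ) (S - Sᵀ) = 0 := by
    rw [inner_eq_trace, Matrix.transpose_sub, Matrix.transpose_transpose, Matrix.sub_mul,
      Matrix.trace_sub, h2, h1]
    simp
  exact (sub_eq_zero.1 (inner_self_eq_zero.1 h3)).symm

theorem geodesic_eq {Q v : Matrix (Fin n) (Fin n) ℝ} {γ : ℝ → Matrix (Fin n) (Fin n) ℝ}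
    (h : IsGeodesicFrom (orthogonalMatrices n) Q v γ) (t : ℝ) :
    γ t = Q * NormedSpace.exp (t • (Qᵀ * v)) := by
  obtain ⟨⟨hs, hm, hn⟩, h0, hv⟩ := h
  have hd : ∀ t, HasDerivAt γ (deriv γ t) t := fun t =>
    (hs.differentiable (by simp) t).hasDerivAt
  have hdd : ∀ t, HasDerivAt (deriv γ) (deriv (deriv γ) t) t := fun t =>
    (((contDiff_infty_iff_deriv.1 hs).2).differentiable (by simp) t).hasDerivAt
  have htan : ∀ t, deriv γ t ∈ tangentSpaceAt (orthogonalMatrices n) (γ t) := fun t =>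
    ⟨fun s => γ (t + s), ⟨by simp, 1, one_pos,
      (hs.comp (contDiff_const.add contDiff_id)).contDiffOn, fun s _ => hm _⟩,
      HasDerivAt.comp_const_add t 0 (by rw [add_zero]; exact hd t)⟩
  have hA : ∀ t, HasDerivAt (fun s => (γ s)ᵀ * deriv γ s)
      ((deriv γ t)ᵀ * deriv γ t + (γ t)ᵀ * deriv (deriv γ) t) t := fun t =>
    (hasDerivAt_transpose (hd t)).mul (hdd t)
  have hsymm : ∀ t, ((γ t)ᵀ * deriv (deriv γ) t)ᵀ = (γ t)ᵀ * deriv (deriv γ) t := fun t => by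
    refine isSymm_of_trace_skew fun B hB => ?_
    rw [Matrix.transpose_mul, Matrix.transpose_transpose, Matrix.mul_assoc]
    exact hn t _ (mul_skew_mem_tangent (hm t) hB)
  have hskew : ∀ t, ((deriv γ t)ᵀ * deriv γ t + (γ t)ᵀ * deriv (deriv γ) t)ᵀ =
      -((deriv γ t)ᵀ * deriv γ t + (γ t)ᵀ * deriv (deriv γ) t) := fun t => by
    have h1 := hasDerivAt_transpose (hA t)
    have h2 : (fun s => ((γ s)ᵀ * deriv γ s)ᵀ) = fun s => -((γ s)ᵀ * deriv γ s) :=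
      funext fun s => transpose_mul_skew (htan s)
    rw [h2] at h1
    exact h1.unique (hA t).neg
  have hzero : ∀ t, (deriv γ t)ᵀ * deriv γ t + (γ t)ᵀ * deriv (deriv γ) t = 0 := fun t => by
    have h1 := hskew t
    rw [Matrix.transpose_add, hsymm t, Matrix.transpose_mul, Matrix.transpose_transpose] at h1
    ext i j
    have h2 := congrFun (congrFun h1 i) j
    rw [Matrix.neg_apply] at h2
    rw [Matrix.zero_apply]
    linarith
  have hconst : ∀ t, (γ t)ᵀ * deriv γ t = Qᵀ * v := fun t => by
    have := is_const_of_deriv_eq_zero (fun s => (hA s).differentiableAt)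
      (fun s => by rw [(hA s).deriv, hzero s]) t 0
    rw [h0] at this
    exact this.trans (congrArg (fun X => Qᵀ * X) hv)
  set A := Qᵀ * v
  have hγ : ∀ t, deriv γ t = γ t * A := fun t => by
    rw [← hconst t, ← Matrix.mul_assoc, mul_transpose_of_mem (hm t), Matrix.one_mul]
  have hE : ∀ t, HasDerivAt (fun s : ℝ => γ s * NormedSpace.exp (s • (-A))) 0 t := fun t => by
    have h1 := (hd t).mul (hasDerivAt_exp_smul_const' (𝕂 := ℝ) (-A) t)
    have h2 : deriv γ t * NormedSpace.exp (t • (-A)) +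
        γ t * (-A * NormedSpace.exp (t • (-A))) = 0 := by
      rw [hγ t, Matrix.mul_assoc, ← Matrix.mul_add, Matrix.neg_mul, add_neg_cancel,
        Matrix.mul_zero]
    exact h2 ▸ h1
  have h3 := is_const_of_deriv_eq_zero (fun s => (hE s).differentiableAt)
    (fun s => (hE s).deriv) t 0
  have h4 : NormedSpace.exp (t • (-A)) * NormedSpace.exp (t • A) = 1 := by
    rw [smul_neg, ← Matrix.exp_add_of_commute _ _ ((Commute.refl (t • A)).neg_left),
      neg_add_cancel, NormedSpace.exp_zero]
  have h5 : γ t * NormedSpace.exp (t • (-A)) = Q := by simpa [h0] using h3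
  rw [← h5, Matrix.mul_assoc, h4, Matrix.mul_one]

theorem geodesic_unique {Q v : Matrix (Fin n) (Fin n) ℝ} {γ₁ γ₂ : ℝ → Matrix (Fin n) (Fin n) ℝ}
    (h₁ : IsGeodesicFrom (orthogonalMatrices n) Q v γ₁)
    (h₂ : IsGeodesicFrom (orthogonalMatrices n) Q v γ₂) : γ₁ = γ₂ :=
  funext fun t => (geodesic_eq h₁ t).trans (geodesic_eq h₂ t).symm

end Geodesics

end SpectralLip

namespace SpectralLip

/-! ### Retractions on compact sets and the gradient Lipschitz inequality -/

section Submanifold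

/-! The objective is `F` composed with `(U, l) ↦ U Diag(l) Uᵀ`, which is linear in `l` and quadratic
in `U`. By the chain rule each partial derivative is a composition `DF(X) ∘ T`. On bounded sets both
factors are bounded and Lipschitz (`DF` grows at most linearly), so the product is Lipschitz: this
is `norm_comp_sub_comp_le`. Orthogonal matrices have norm `√n` and `‖l‖ ≤ D`, so all constants are
uniform. For fixed orthogonal `Q`, the map in `l` is an isometry, which gives the constant `L_F`
itself.

The retraction inequality rests on a uniform bound `‖R x v - x - v‖ ≤ K ‖v‖ ^ 2`: locally it is
Taylor's formula in `v`, compactness makes it uniform for short `v`, and long `v` are handled by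
boundedness. Expanding an ambient function `h` around `x` then gives `Dh(x) v` plus terms of order
`‖v‖ ^ 2`. The exponential map needs no separate argument: `Q exp(Qᵀ v)` shows that it is itself a
retraction. -/

/-- Mean value inequality on the segment, relative to the fixed linear map `fderiv ℝ f x`. It gives
`K` instead of the sharp `K / 2`, which suffices where constants only have to exist. -/
theorem norm_image_sub_sub_le_of_lipschitz_fderiv {E F : Type*} [NormedAddCommGroup E]
    [NormedSpace ℝ E] [NormedAddCommGroup F] [NormedSpace ℝ F] {f : E → F} {s : Set E}
    (hs : Convex ℝ s) (hf : ∀ x ∈ s, DifferentiableAt ℝ f x) {K : ℝ} (hK : 0 ≤ K)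
    (hlip : ∀ x ∈ s, ∀ y ∈ s, ‖fderiv ℝ f x - fderiv ℝ f y‖ ≤ K * ‖x - y‖)
    {x y : E} (hx : x ∈ s) (hy : y ∈ s) :
    ‖f y - f x - fderiv ℝ f x (y - x)‖ ≤ K * ‖y - x‖ ^ 2 := by
  have hseg : segment ℝ x y ⊆ s := hs.segment_subset hx hy
  have h := (convex_segment x y).norm_image_sub_le_of_norm_fderiv_le' (𝕜 := ℝ)
    (φ := fderiv ℝ f x) (C := K * ‖y - x‖) (fun z hz => hf z (hseg hz))
    (fun z hz => (hlip z (hseg hz) x hx).trans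
      (mul_le_mul_of_nonneg_left (norm_sub_le_of_mem_segment hz) hK))
    (left_mem_segment ℝ x y) (right_mem_segment ℝ x y)
  rwa [mul_assoc, ← sq] at h

variable {E : Type*} [NormedAddCommGroup E] [InnerProductSpace ℝ E]

theorem smul_mem_tangentSpaceAt {M : Set E} {x v : E} (hv : v ∈ tangentSpaceAt M x) (a : ℝ) :
    a • v ∈ tangentSpaceAt M x := by
  obtain ⟨c, ⟨h0, ε, hε, hc, hm⟩, hd⟩ := hv
  -- The summand `1` keeps the new radius `ε / (|a| + 1)` meaningful when `a = 0`.
  have ha : 0 < |a| + 1 := by positivity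
  have hmaps : MapsTo (fun t : ℝ => a * t) (Ioo (-(ε / (|a| + 1))) (ε / (|a| + 1)))
      (Ioo (-ε) ε) := fun t ht => by
    have ht' : |t| < ε / (|a| + 1) := abs_lt.2 ht
    rw [lt_div_iff₀ ha] at ht'
    refine abs_lt.1 ?_
    rw [abs_mul]
    nlinarith [abs_nonneg t, abs_nonneg a]
  refine ⟨fun t => c (a * t), ⟨by simpa using h0, ε / (|a| + 1), by positivity,
    hc.comp (contDiff_const.mul contDiff_id).contDiffOn hmaps, fun t ht => hm _ (hmaps ht)⟩, ?_⟩
  have h1 : HasDerivAt (fun t : ℝ => a * t) a 0 := by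
    simpa using (hasDerivAt_id (0 : ℝ)).const_mul a
  have h2 : HasDerivAt c v (a * 0) := by rwa [mul_zero]
  exact h2.scomp 0 h1

theorem zero_mem_tangentSpaceAt {M : Set E} {x : E} (hx : x ∈ M) :
    (0 : E) ∈ tangentSpaceAt M x :=
  ⟨fun _ => x, ⟨rfl, 1, one_pos, contDiffOn_const, fun _ _ => hx⟩, hasDerivAt_const _ _⟩

/-- Let `S` be a smooth extension of `R` near `(x₀, 0)`. Its derivative is Lipschitz there, and `S
(x, 0) = x`, `DS(x, 0)(0, v) = v` for tangent `v`. So `R x v - x - v` is the first-order Taylor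
remainder of `S` from `(x, 0)` to `(x, v)`. -/
theorem IsRetraction.exists_local_quadratic_bound {M : Set E} {R : E → E → E}
    (hR : IsRetraction M R) {x₀ : E} (hx₀ : x₀ ∈ M) :
    ∃ δ > 0, ∃ K : ℝ, 0 ≤ K ∧ ∀ x ∈ M, ‖x - x₀‖ < δ → ∀ v ∈ tangentSpaceAt M x, ‖v‖ < δ →
      ‖R x v - x - v‖ ≤ K * ‖v‖ ^ 2 := by
  obtain ⟨U, hU, hpU, S, hS, hSR⟩ := hR.smooth (x₀, 0) ⟨hx₀, zero_mem_tangentSpaceAt hx₀⟩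
  have hcd : ContDiffAt ℝ ∞ S (x₀, 0) := hS.contDiffAt (hU.mem_nhds hpU)
  obtain ⟨K, t, ht, hlip⟩ := (hcd.fderiv_right (m := 1) (by norm_cast)).exists_lipschitzOnWith
  obtain ⟨δ, hδ, hball⟩ := Metric.mem_nhds_iff.1 (inter_mem ht (hU.mem_nhds hpU))
  refine ⟨δ, hδ, K, K.2, fun x hx hxδ v hv hvδ => ?_⟩
  have hmem : ∀ a : ℝ, |a| ≤ 1 → (x, a • v) ∈ Metric.ball (x₀, (0 : E)) δ := fun a ha => by
    rw [← ball_prod_same, mem_prod, mem_ball_iff_norm, mem_ball_zero_iff,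
      norm_smul]
    exact ⟨hxδ, (mul_le_of_le_one_left (norm_nonneg v) ha).trans_lt hvδ⟩
  have hdiff : ∀ q ∈ Metric.ball (x₀, (0 : E)) δ, DifferentiableAt ℝ S q := fun q hq =>
    (hS.contDiffAt (hU.mem_nhds (hball hq).2)).differentiableAt (by simp)
  have heq : ∀ a : ℝ, |a| ≤ 1 → S (x, a • v) = R x (a • v) := fun a ha =>
    hSR _ ⟨(hball (hmem a ha)).2, hx, smul_mem_tangentSpaceAt hv a⟩
  have h0 : S (x, 0) = x := by simpa [hR.zero x hx] using heq 0 (by simp)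
  have h1 : S (x, v) = R x v := by simpa using heq 1 (by simp)
  have hm0 : (x, (0 : E)) ∈ Metric.ball (x₀, (0 : E)) δ := by simpa using hmem 0 (by simp)
  have hm1 : (x, v) ∈ Metric.ball (x₀, (0 : E)) δ := by simpa using hmem 1 (by simp)
  -- `S` and `R` agree only on the tangent bundle, but the curve `a ↦ (x, a • v)` stays in it;
  -- differentiating along it determines `DS` in the direction `(0, v)`.
  have hder : fderiv ℝ S (x, 0) (0, v) = v := by
    have hline : HasDerivAt (fun a : ℝ => (x, a • v)) ((0 : E), v) 0 := by
      simpa using (hasDerivAt_const (0 : ℝ) x).prodMk ((hasDerivAt_id (0 : ℝ)).smul_const v)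
    have hS0 : HasFDerivAt S (fderiv ℝ S (x, 0)) (x, (0 : ℝ) • v) := by
      rw [zero_smul]
      exact (hdiff _ hm0).hasFDerivAt
    refine (hS0.comp_hasDerivAt 0 hline).unique
      ((hR.deriv_zero x hx v hv).congr_of_eventuallyEq ?_)
    filter_upwards [Ioo_mem_nhds (neg_lt_zero.2 one_pos) one_pos] with a ha
    exact heq a (abs_lt.2 ha).le
  have hq := norm_image_sub_sub_le_of_lipschitz_fderiv (convex_ball (x₀, (0 : E)) δ) hdiff K.2
    (fun p hp q hq => by
      rw [← dist_eq_norm, ← dist_eq_norm]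
      exact hlip.dist_le_mul p (hball hp).1 q (hball hq).1) hm0 hm1
  have hsub : (x, v) - (x, (0 : E)) = (0, v) := by simp
  have hnorm : ‖((0 : E), v)‖ = ‖v‖ := by simp [Prod.norm_def]
  rwa [hsub, hder, hnorm, h0, h1] at hq

/-- Compactness makes the local radius and constant uniform. Beyond that radius the left side is at
most `2 * B + ‖v‖`, which a quadratic dominates. -/
theorem IsRetraction.exists_quadratic_bound {M : Set E} (hM : IsCompact M) {R : E → E → E}
    (hR : IsRetraction M R) :
    ∃ K : ℝ, 0 ≤ K ∧ ∀ x ∈ M, ∀ v ∈ tangentSpaceAt M x, ‖R x v - x - v‖ ≤ K * ‖v‖ ^ 2 := by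
  obtain ⟨δ, hδ, K, hK, hloc⟩ : ∃ δ > 0, ∃ K : ℝ, 0 ≤ K ∧ ∀ x ∈ M, ∀ v ∈ tangentSpaceAt M x,
      ‖v‖ < δ → ‖R x v - x - v‖ ≤ K * ‖v‖ ^ 2 := by
    refine (hM.induction_on (p := fun s => ∃ δ > 0, ∃ K : ℝ, 0 ≤ K ∧ ∀ x ∈ s, x ∈ M →
      ∀ v ∈ tangentSpaceAt M x, ‖v‖ < δ → ‖R x v - x - v‖ ≤ K * ‖v‖ ^ 2) ?_ ?_ ?_ ?_).imp
      fun δ ⟨hδ, K, hK, h⟩ => ⟨hδ, K, hK, fun x hx => h x hx hx⟩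
    · exact ⟨1, one_pos, 0, le_rfl, fun x hx => hx.elim⟩
    · rintro s t hst ⟨δ, hδ, K, hK, h⟩
      exact ⟨δ, hδ, K, hK, fun x hx => h x (hst hx)⟩
    · rintro s t ⟨δ, hδ, K, hK, h⟩ ⟨δ', hδ', K', hK', h'⟩
      refine ⟨min δ δ', lt_min hδ hδ', max K K', hK.trans (le_max_left _ _), ?_⟩
      rintro x (hx | hx) hxM v hv hvδ
      · exact (h x hx hxM v hv (hvδ.trans_le (min_le_left _ _))).trans
          (by gcongr; exact le_max_left _ _)
      · exact (h' x hx hxM v hv (hvδ.trans_le (min_le_right _ _))).trans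
          (by gcongr; exact le_max_right _ _)
    · intro x₀ hx₀
      obtain ⟨δ, hδ, K, hK, h⟩ := hR.exists_local_quadratic_bound hx₀
      refine ⟨Metric.ball x₀ δ, mem_nhdsWithin_of_mem_nhds (Metric.ball_mem_nhds x₀ hδ), δ, hδ, K,
        hK, fun x hx hxM => h x hxM (mem_ball_iff_norm.1 hx)⟩
  obtain ⟨B, hB, hMB⟩ := hM.isBounded.exists_pos_norm_le
  -- For `‖v‖ ≥ δ`, multiply `2 * B` by `(‖v‖ / δ) ^ 2 ≥ 1` and `‖v‖` by `‖v‖ / δ ≥ 1`.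
  refine ⟨max K (2 * B / δ ^ 2 + 1 / δ), hK.trans (le_max_left _ _), fun x hx v hv => ?_⟩
  rcases lt_or_ge ‖v‖ δ with hvδ | hvδ
  · exact (hloc x hx v hv hvδ).trans (by gcongr; exact le_max_left _ _)
  · have h1 : ‖R x v - x - v‖ ≤ 2 * B + ‖v‖ := by
      have := norm_sub_le (R x v - x) v
      have := norm_sub_le (R x v) x
      linarith [hMB _ (hR.mapsTo x hx v hv), hMB x hx]
    have h2 : 1 ≤ ‖v‖ / δ := (one_le_div hδ).2 hvδ
    have h3 : 2 * B + ‖v‖ ≤ (2 * B / δ ^ 2 + 1 / δ) * ‖v‖ ^ 2 := by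
      have e : (2 * B / δ ^ 2 + 1 / δ) * ‖v‖ ^ 2 = 2 * B * (‖v‖ / δ) ^ 2 + ‖v‖ * (‖v‖ / δ) := by
        field_simp
      rw [e]
      exact add_le_add (le_mul_of_one_le_right (by positivity) (one_le_pow₀ h2))
        (le_mul_of_one_le_right (norm_nonneg v) h2)
    exact h1.trans (h3.trans (by gcongr; exact le_max_right _ _))

/-- For `‖v‖ ≤ 1` the quadratic error is absorbed into a linear one; for `‖v‖ ≥ 1` the distance is
at most `2 * B ≤ 2 * B * ‖v‖`. -/
theorem IsRetraction.norm_sub_le_of_quadratic_bound {M : Set E} {R : E → E → E}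
    (hR : IsRetraction M R) {B K : ℝ} (hB : ∀ x ∈ M, ‖x‖ ≤ B) (hK : 0 ≤ K) {x v : E} (hx : x ∈ M)
    (hv : v ∈ tangentSpaceAt M x) (h : ‖R x v - x - v‖ ≤ K * ‖v‖ ^ 2) :
    ‖R x v - x‖ ≤ (1 + K + 2 * B) * ‖v‖ := by
  have hB0 : 0 ≤ B := (norm_nonneg x).trans (hB x hx)
  have hv0 := norm_nonneg v
  rcases le_total ‖v‖ 1 with h1 | h1
  · have h2 : ‖R x v - x‖ ≤ ‖R x v - x - v‖ + ‖v‖ := by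
      simpa using norm_add_le (R x v - x - v) v
    nlinarith [mul_nonneg hK hv0, mul_nonneg hB0 hv0,
      mul_le_mul_of_nonneg_left h1 (mul_nonneg hK hv0)]
  · have h2 := norm_sub_le (R x v) x
    have h3 := hB x hx
    have h4 := hB _ (hR.mapsTo x hx v hv)
    nlinarith [mul_nonneg hK hv0, mul_le_mul_of_nonneg_left h1 hB0]

/-- A function whose derivative is bounded and Lipschitz on a ball around a compact `M` has a
gradient Lipschitz retraction with a constant that depends only on the bounds. -/
theorem IsRetraction.exists_hasGradLipRetraction {M : Set E} (hM : IsCompact M) {R : E → E → E}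
    (hR : IsRetraction M R) {B K N : ℝ} (hB : ∀ x ∈ M, ‖x‖ ≤ B) (hK : 0 ≤ K) (hN : 0 ≤ N) :
    ∃ L : ℝ, ∀ h : E → ℝ, Differentiable ℝ h →
      (∀ x ∈ Metric.closedBall (0 : E) B, ∀ y ∈ Metric.closedBall (0 : E) B,
        ‖fderiv ℝ h x - fderiv ℝ h y‖ ≤ K * ‖x - y‖) →
      (∀ x ∈ M, ‖fderiv ℝ h x‖ ≤ N) →
      (∀ x ∈ M, ∃ g ∈ tangentSpaceAt M x, ∀ v ∈ tangentSpaceAt M x,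
        inner ℝ v g = fderiv ℝ h x v) →
      ∀ L' ≥ L, HasGradLipRetraction M R h L' := by
  obtain ⟨K', hK', hq⟩ := hR.exists_quadratic_bound hM
  -- `N * K'` comes from replacing `R x v - x` by `v` in the linear term, the other summand from the
  -- Taylor remainder of `h`; the factor `2` offsets `L / 2`.
  refine ⟨2 * (N * K' + K * (1 + K' + 2 * B) ^ 2), fun h hd hlip hbd hgrad L' hL' x hx => ?_⟩
  obtain ⟨g, hg, hgv⟩ := hgrad x hx
  refine ⟨g, ⟨hg, fun c v hc hcv => ?_⟩, fun v hv => ?_⟩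
  · rw [hgv v ⟨c, hc, hcv⟩]
    have h1 : HasFDerivAt h (fderiv ℝ h x) (c 0) := by
      rw [hc.1]
      exact (hd x).hasFDerivAt
    exact h1.comp_hasDerivAt 0 hcv
  · have hRx := hR.mapsTo x hx v hv
    -- The segment from `x` to `R x v` may leave `M`, so the expansion takes place in a convex ball
    -- containing `M`.
    have h1 := norm_image_sub_sub_le_of_lipschitz_fderiv (convex_closedBall (0 : E) B)
      (fun y _ => hd y) hK hlip (mem_closedBall_zero_iff.2 (hB x hx))
      (mem_closedBall_zero_iff.2 (hB _ hRx))
    have h2 := (le_abs_self _).trans h1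
    have h3 := hR.norm_sub_le_of_quadratic_bound hB hK' hx hv (hq x hx v hv)
    have h4 : ‖R x v - x‖ ^ 2 ≤ ((1 + K' + 2 * B) * ‖v‖) ^ 2 := by gcongr
    have h5 : fderiv ℝ h x (R x v - x) ≤ fderiv ℝ h x v + N * (K' * ‖v‖ ^ 2) := by
      have e : fderiv ℝ h x (R x v - x) = fderiv ℝ h x v + fderiv ℝ h x (R x v - x - v) := by
        rw [← map_add, add_sub_cancel]
      rw [e]
      gcongr
      exact (le_abs_self _).trans (((fderiv ℝ h x).le_opNorm _).trans
        (mul_le_mul (hbd x hx) (hq x hx v hv) (norm_nonneg _) hN))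
    have h6 := mul_le_mul_of_nonneg_left h4 hK
    have h7 := mul_le_mul_of_nonneg_right hL' (sq_nonneg ‖v‖)
    rw [real_inner_comm, hgv v hv]
    rw [mul_pow] at h6
    linarith

end Submanifold

/-! ### Orthogonal matrices, their exponential map, and the conjugation map -/

section Matrices

attribute [local instance] Matrix.frobeniusNormedRing Matrix.frobeniusNormedAlgebra

open Matrix

variable {n : ℕ}

theorem norm_transpose (A : Matrix (Fin n) (Fin n) ℝ) : ‖Aᵀ‖ = ‖A‖ :=
  Matrix.frobenius_norm_transpose A

theorem norm_diagonal (l : EuclideanSpace ℝ (Fin n)) :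
    ‖(diagonal (fun i => l i) : Matrix (Fin n) (Fin n) ℝ)‖ = ‖l‖ :=
  Matrix.frobenius_norm_diagonal _

theorem norm_mul_mul_le (A B C : Matrix (Fin n) (Fin n) ℝ) :
    ‖A * B * C‖ ≤ ‖A‖ * ‖B‖ * ‖C‖ :=
  (norm_mul_le _ _).trans (by gcongr; exact norm_mul_le _ _)

theorem norm_sq_eq_trace (A : Matrix (Fin n) (Fin n) ℝ) : ‖A‖ ^ 2 = (Aᵀ * A).trace := by
  rw [← real_inner_self_eq_norm_sq, inner_eq_trace]

theorem norm_of_mem_orthogonalMatrices {Q : Matrix (Fin n) (Fin n) ℝ}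
    (hQ : Q ∈ orthogonalMatrices n) : ‖Q‖ = √n := by
  have h := norm_sq_eq_trace Q
  rw [mem_orthogonalMatrices.1 hQ, Matrix.trace_one, Fintype.card_fin] at h
  rw [← h, Real.sqrt_sq (norm_nonneg Q)]

theorem norm_conj_of_mem_orthogonalMatrices {Q : Matrix (Fin n) (Fin n) ℝ}
    (hQ : Q ∈ orthogonalMatrices n) (A : Matrix (Fin n) (Fin n) ℝ) : ‖Q * A * Qᵀ‖ = ‖A‖ := by
  have hQ' := mem_orthogonalMatrices.1 hQ
  refine (sq_eq_sq₀ (norm_nonneg _) (norm_nonneg _)).1 ?_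
  have e : (Q * A * Qᵀ)ᵀ * (Q * A * Qᵀ) = Q * (Aᵀ * A * Qᵀ) := by
    calc (Q * A * Qᵀ)ᵀ * (Q * A * Qᵀ) = Q * (Aᵀ * (Qᵀ * Q) * A * Qᵀ) := by
          simp only [Matrix.transpose_mul, Matrix.transpose_transpose, Matrix.mul_assoc]
      _ = _ := by rw [hQ', Matrix.mul_one]
  rw [norm_sq_eq_trace, norm_sq_eq_trace, e, Matrix.trace_mul_comm, Matrix.mul_assoc, hQ',
    Matrix.mul_one]

theorem isCompact_orthogonalMatrices : IsCompact (orthogonalMatrices n) := by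
  refine Metric.isCompact_of_isClosed_isBounded ?_ ?_
  · have h : orthogonalMatrices n = {Q | Qᵀ * Q = 1} := Set.ext fun Q => mem_orthogonalMatrices
    rw [h]
    exact isClosed_eq (by fun_prop) continuous_const
  · exact (Metric.isBounded_closedBall (x := 0) (r := √n)).subset fun Q hQ =>
      mem_closedBall_zero_iff.2 (norm_of_mem_orthogonalMatrices hQ).le

theorem convexHull_orthogonalMatrices_subset :
    convexHull ℝ (orthogonalMatrices n) ⊆ Metric.closedBall 0 √n :=
  convexHull_min (fun _ hQ => mem_closedBall_zero_iff.2 (norm_of_mem_orthogonalMatrices hQ).le)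
    (convex_closedBall _ _)

theorem riemannianExp_eq {Q v : Matrix (Fin n) (Fin n) ℝ} (hQ : Q ∈ orthogonalMatrices n)
    (hv : v ∈ tangentSpaceAt (orthogonalMatrices n) Q) :
    riemannianExp (orthogonalMatrices n) Q v = Q * NormedSpace.exp (Qᵀ * v) := by
  have h := exists_geodesic hQ hv
  rw [riemannianExp, dif_pos h, geodesic_eq h.choose_spec 1, one_smul]

/-- The closed formula `Q exp(Qᵀ v)` is smooth on the whole ambient space, so it serves as a global
smooth extension. -/
theorem isRetraction_riemannianExp :
    IsRetraction (orthogonalMatrices n) (riemannianExp (orthogonalMatrices n)) where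
  mapsTo Q hQ v hv := by
    rw [riemannianExp_eq hQ hv]
    simpa using mul_mem_orthogonal hQ (exp_skew_mem (transpose_mul_skew hv) 1)
  smooth p _ := by
    refine ⟨univ, isOpen_univ, mem_univ _, fun q => q.1 * NormedSpace.exp (q.1ᵀ * q.2), ?_,
      fun q hq => (riemannianExp_eq hq.2.1 hq.2.2).symm⟩
    have h : ContDiff ℝ ∞ (NormedSpace.exp : Matrix (Fin n) (Fin n) ℝ → _) :=
      contDiff_iff_contDiffAt.2 fun x => (NormedSpace.exp_analytic (𝕂 := ℝ) x).contDiffAt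
    have ht : ContDiff ℝ ∞ (fun q : Matrix (Fin n) (Fin n) ℝ × Matrix (Fin n) (Fin n) ℝ => q.1ᵀ) :=
      (LinearMap.toContinuousLinearMap
        (Matrix.transposeLinearEquiv (Fin n) (Fin n) ℝ ℝ).toLinearMap).contDiff.comp contDiff_fst
    exact (contDiff_fst.mul (h.comp (ht.mul contDiff_snd))).contDiffOn
  zero Q hQ := by
    rw [riemannianExp_eq hQ (zero_mem_tangentSpaceAt hQ)]
    simp
  deriv_zero Q hQ v hv := by
    have h := hasDerivAt_mul_exp Q (Qᵀ * v) 0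
    rw [zero_smul, NormedSpace.exp_zero, mul_one, ← mul_assoc, mul_transpose_of_mem hQ,
      one_mul] at h
    refine h.congr_of_eventuallyEq (Eventually.of_forall fun t => ?_)
    simp only [riemannianExp_eq hQ (smul_mem_tangentSpaceAt hv t), Matrix.mul_smul]

/-- The topology of the Frobenius norm. It is the product topology, but only the present form is
seen by instance search to be that of a normed space. -/
noncomputable abbrev frobeniusTopology (n : ℕ) : TopologicalSpace (Matrix (Fin n) (Fin n) ℝ) :=
  letI : NormedAddCommGroup (Matrix (Fin n) (Fin n) ℝ) := Matrix.frobeniusNormedAddCommGroup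
  PseudoMetricSpace.toUniformSpace.toTopologicalSpace

attribute [local instance] frobeniusTopology

/-- If `W` represents `φ`, its tangential projection is `Q` times the skew part of `Qᵀ W`. Tangent
vectors are `Q A` with `A` skew, and a skew `A` pairs to zero with the symmetric part. -/
theorem exists_tangent_representative {Q : Matrix (Fin n) (Fin n) ℝ}
    (hQ : Q ∈ orthogonalMatrices n) (φ : Matrix (Fin n) (Fin n) ℝ →L[ℝ] ℝ) :
    ∃ g ∈ tangentSpaceAt (orthogonalMatrices n) Q,
      ∀ v ∈ tangentSpaceAt (orthogonalMatrices n) Q, inner ℝ v g = φ v := by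
  obtain ⟨W, hW⟩ : ∃ W, ∀ v, inner ℝ W v = φ v :=
    ⟨(InnerProductSpace.toDual ℝ _).symm φ, fun v => InnerProductSpace.toDual_symm_apply⟩
  set S := Qᵀ * W with hS
  have hskew : ((1 / 2 : ℝ) • (S - Sᵀ))ᵀ = -((1 / 2 : ℝ) • (S - Sᵀ)) := by
    rw [Matrix.transpose_smul, Matrix.transpose_sub, Matrix.transpose_transpose, ← smul_neg,
      neg_sub]
  refine ⟨_, mul_skew_mem_tangent hQ hskew, fun v hv => ?_⟩
  rw [← hW, real_inner_comm v W, inner_eq_trace, inner_eq_trace]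
  have hA := transpose_mul_skew hv
  set A := Qᵀ * v with hAdef
  have hv' : v = Q * A := by rw [hAdef, ← Matrix.mul_assoc, mul_transpose_of_mem hQ, Matrix.one_mul]
  have e1 : vᵀ * W = -(A * S) := by
    rw [hv', Matrix.transpose_mul, hA, hS, Matrix.mul_assoc, Matrix.neg_mul]
  have e2 : vᵀ * (Q * ((1 / 2 : ℝ) • (S - Sᵀ))) = -((1 / 2 : ℝ) • (A * S - A * Sᵀ)) := by
    rw [hv', Matrix.transpose_mul, hA, ← Matrix.mul_assoc, Matrix.mul_assoc (-A),
      mem_orthogonalMatrices.1 hQ, Matrix.mul_one, Matrix.mul_smul, Matrix.neg_mul,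
      Matrix.mul_sub, smul_neg]
  have e3 : (A * Sᵀ).trace = -(A * S).trace := by
    rw [← Matrix.trace_transpose, Matrix.transpose_mul, Matrix.transpose_transpose, hA,
      Matrix.mul_neg, Matrix.trace_neg, Matrix.trace_mul_comm]
  rw [e1, e2, Matrix.trace_neg, Matrix.trace_neg, Matrix.trace_smul, Matrix.trace_sub, e3,
    smul_eq_mul]
  ring

/-- The linear map `l ↦ U Diag(l) Uᵀ`. -/
noncomputable def conjDiagCLM (U : Matrix (Fin n) (Fin n) ℝ) :
    EuclideanSpace ℝ (Fin n) →L[ℝ] symMatrix n :=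
  LinearMap.toContinuousLinearMap
    { toFun := conjDiag U
      map_add' := fun l m => Subtype.ext <| by
        simp [conjDiag, ← Matrix.diagonal_add, Matrix.mul_add, Matrix.add_mul]
      map_smul' := fun a l => Subtype.ext <| by
        have h : (diagonal fun i => (a • l) i : Matrix (Fin n) (Fin n) ℝ) =
            a • diagonal fun i => l i := by
          rw [← Matrix.diagonal_smul]
          rfl
        change U * diagonal (fun i => (a • l) i) * Uᵀ = a • (U * diagonal (fun i => l i) * Uᵀ)
        rw [h, Matrix.mul_smul, Matrix.smul_mul] }

theorem norm_conjDiag_le (U : Matrix (Fin n) (Fin n) ℝ) (l : EuclideanSpace ℝ (Fin n)) :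
    ‖conjDiag U l‖ ≤ ‖U‖ ^ 2 * ‖l‖ := by
  refine (norm_mul_mul_le U _ Uᵀ).trans_eq ?_
  rw [norm_transpose, norm_diagonal]
  ring

theorem norm_conjDiag_sub_le (U V : Matrix (Fin n) (Fin n) ℝ) (l : EuclideanSpace ℝ (Fin n)) :
    ‖conjDiag U l - conjDiag V l‖ ≤ (‖U‖ + ‖V‖) * ‖l‖ * ‖U - V‖ := by
  -- One of the two outer factors is changed at a time.
  have e : ((conjDiag U l - conjDiag V l : symMatrix n) : Matrix (Fin n) (Fin n) ℝ) =
      (U - V) * diagonal (fun i => l i) * Uᵀ + V * diagonal (fun i => l i) * (U - V)ᵀ := by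
    simp only [conjDiag, Submodule.coe_sub, Matrix.transpose_sub, Matrix.sub_mul, Matrix.mul_sub]
    abel
  change ‖((conjDiag U l - conjDiag V l : symMatrix n) : Matrix (Fin n) (Fin n) ℝ)‖ ≤ _
  rw [e]
  refine (norm_add_le _ _).trans ((add_le_add (norm_mul_mul_le _ _ _)
    (norm_mul_mul_le _ _ _)).trans_eq ?_)
  rw [norm_transpose, norm_transpose, norm_diagonal]
  ring

/-- Orthogonal conjugation preserves the Frobenius norm; the submultiplicative bound would only give
`n`. -/
theorem norm_conjDiagCLM_le_one {Q : Matrix (Fin n) (Fin n) ℝ} (hQ : Q ∈ orthogonalMatrices n) :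
    ‖conjDiagCLM Q‖ ≤ 1 :=
  ContinuousLinearMap.opNorm_le_bound _ zero_le_one fun l => by
    rw [one_mul]
    exact ((norm_conj_of_mem_orthogonalMatrices hQ _).trans (norm_diagonal l)).le

theorem norm_conjDiagCLM_sub_le (U V : Matrix (Fin n) (Fin n) ℝ) :
    ‖conjDiagCLM U - conjDiagCLM V‖ ≤ (‖U‖ + ‖V‖) * ‖U - V‖ :=
  ContinuousLinearMap.opNorm_le_bound _ (by positivity) fun l =>
    (norm_conjDiag_sub_le U V l).trans_eq (by ring)

/-- The symmetric bilinear map `(U, H) ↦ U Diag(l) Hᵀ + H Diag(l) Uᵀ`. -/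
noncomputable def conjDiagPolar (l : EuclideanSpace ℝ (Fin n)) :
    Matrix (Fin n) (Fin n) ℝ →L[ℝ] Matrix (Fin n) (Fin n) ℝ →L[ℝ] symMatrix n :=
  LinearMap.mkContinuous₂
    (LinearMap.mk₂ ℝ
      (fun U H => (⟨U * diagonal (fun i => l i) * Hᵀ + H * diagonal (fun i => l i) * Uᵀ, by
        simp [symMatrix, Matrix.IsSymm, Matrix.mul_assoc, add_comm]⟩ : symMatrix n))
      (fun U V H => Subtype.ext <| by
        simp only [Submodule.coe_add, Matrix.transpose_add, Matrix.add_mul, Matrix.mul_add]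
        abel)
      (fun a U H => Subtype.ext <| by simp)
      (fun U H K => Subtype.ext <| by
        simp only [Submodule.coe_add, Matrix.transpose_add, Matrix.add_mul, Matrix.mul_add]
        abel)
      (fun a U H => Subtype.ext <| by simp))
    (2 * ‖l‖)
    (fun U H => by
      refine (norm_add_le _ _).trans ((add_le_add (norm_mul_mul_le _ _ _)
        (norm_mul_mul_le _ _ _)).trans_eq ?_)
      rw [norm_transpose, norm_transpose, norm_diagonal]
      ring)

theorem coe_conjDiagPolar (l : EuclideanSpace ℝ (Fin n)) (U H : Matrix (Fin n) (Fin n) ℝ) :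
    (conjDiagPolar l U H : Matrix (Fin n) (Fin n) ℝ) =
      U * diagonal (fun i => l i) * Hᵀ + H * diagonal (fun i => l i) * Uᵀ := rfl

theorem norm_conjDiagPolar_le (l : EuclideanSpace ℝ (Fin n)) (U : Matrix (Fin n) (Fin n) ℝ) :
    ‖conjDiagPolar l U‖ ≤ 2 * ‖l‖ * ‖U‖ :=
  ContinuousLinearMap.opNorm_le_bound _ (by positivity) fun H => by
    refine (norm_add_le (U * diagonal (fun i => l i) * Hᵀ) (H * diagonal (fun i => l i) * Uᵀ)).trans
      ((add_le_add (norm_mul_mul_le _ _ _) (norm_mul_mul_le _ _ _)).trans_eq ?_)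
    rw [norm_transpose, norm_transpose, norm_diagonal]
    ring

theorem norm_conjDiagPolar_sub_le (l : EuclideanSpace ℝ (Fin n))
    (U V : Matrix (Fin n) (Fin n) ℝ) :
    ‖conjDiagPolar l U - conjDiagPolar l V‖ ≤ 2 * ‖l‖ * ‖U - V‖ := by
  have e : conjDiagPolar l U - conjDiagPolar l V = conjDiagPolar l (U - V) := by
    refine ContinuousLinearMap.ext fun H => Subtype.ext ?_
    rw [_root_.sub_apply, Submodule.coe_sub, coe_conjDiagPolar, coe_conjDiagPolar,
      coe_conjDiagPolar]
    simp only [Matrix.transpose_sub, Matrix.sub_mul, Matrix.mul_sub]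
    abel
  rw [e]
  exact norm_conjDiagPolar_le l _

/-- A quadratic map is half its polar form on the diagonal; by symmetry the two terms of the product
rule coincide and cancel the half. -/
theorem hasFDerivAt_conjDiag (l : EuclideanSpace ℝ (Fin n)) (U : Matrix (Fin n) (Fin n) ℝ) :
    HasFDerivAt (fun V => conjDiag V l) (conjDiagPolar l U) U := by
  have e : (fun V => conjDiag V l) = fun V => (1 / 2 : ℝ) • conjDiagPolar l V V :=
    funext fun V => Subtype.ext <| by
      rw [Submodule.coe_smul, coe_conjDiagPolar, ← two_smul ℝ, smul_smul]
      norm_num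
      rfl
  have h := (ContinuousLinearMap.hasFDerivAt_of_bilinear (conjDiagPolar l)
    (hasFDerivAt_id (𝕜 := ℝ) U) (hasFDerivAt_id U)).const_smul (1 / 2 : ℝ)
  rw [e]
  refine h.congr_fderiv (ContinuousLinearMap.ext fun H => Subtype.ext ?_)
  have hs : conjDiagPolar l H U = conjDiagPolar l U H := Subtype.ext (add_comm _ _)
  have h2 : (1 / 2 : ℝ) • (conjDiagPolar l U H + conjDiagPolar l H U) = conjDiagPolar l U H := by
    rw [hs, ← two_smul ℝ, smul_smul]
    norm_num
  exact congrArg Subtype.val h2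

end Matrices

/-! ### Gradients versus derivatives, and differences of compositions -/

section Composition

/-- The Riesz map is a linear isometry, so all estimates can be made on derivatives, where the chain
rule is available. -/
theorem norm_gradient_sub {H : Type*} [NormedAddCommGroup H] [InnerProductSpace ℝ H]
    [CompleteSpace H] (f g : H → ℝ) (x y : H) :
    ‖∇ f x - ∇ g y‖ = ‖fderiv ℝ f x - fderiv ℝ g y‖ := by
  rw [gradient, gradient, ← map_sub, LinearIsometryEquiv.norm_map]

theorem norm_comp_sub_comp_le {E F G : Type*} [NormedAddCommGroup E] [NormedSpace ℝ E]
    [NormedAddCommGroup F] [NormedSpace ℝ F] [NormedAddCommGroup G] [NormedSpace ℝ G]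
    (a a' : F →L[ℝ] G) (b b' : E →L[ℝ] F) :
    ‖a.comp b - a'.comp b'‖ ≤ ‖a - a'‖ * ‖b‖ + ‖a'‖ * ‖b - b'‖ := by
  have e : a.comp b - a'.comp b' = (a - a').comp b + a'.comp (b - b') := by
    ext x
    simp
  rw [e]
  exact (norm_add_le _ _).trans
    (add_le_add (ContinuousLinearMap.opNorm_comp_le _ _) (ContinuousLinearMap.opNorm_comp_le _ _))

end Composition

/-! ### Lipschitz estimates for the spectral objective -/

section Objective

attribute [local instance] frobeniusTopology

variable {n : ℕ} {F : symMatrix n → ℝ} {L : ℝ}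

theorem hasFDerivAt_spectralObjective_right (hF : Differentiable ℝ F)
    (U : Matrix (Fin n) (Fin n) ℝ) (l : EuclideanSpace ℝ (Fin n)) :
    HasFDerivAt (spectralObjective F U) ((fderiv ℝ F (conjDiag U l)).comp (conjDiagCLM U)) l :=
  (hF (conjDiag U l)).hasFDerivAt.comp l (conjDiagCLM U).hasFDerivAt

theorem hasFDerivAt_spectralObjective_left (hF : Differentiable ℝ F)
    (U : Matrix (Fin n) (Fin n) ℝ) (l : EuclideanSpace ℝ (Fin n)) :
    HasFDerivAt (fun V => spectralObjective F V l)
      ((fderiv ℝ F (conjDiag U l)).comp (conjDiagPolar l U)) U :=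
  (hF (conjDiag U l)).hasFDerivAt.comp U (hasFDerivAt_conjDiag l U)

/-- Comparison with the derivative at `0`: this bounds `DF` on bounded sets although `F` has no
global bound on its derivative. -/
theorem norm_fderiv_le_of_lipschitz
    (hL : ∀ X Y, ‖fderiv ℝ F X - fderiv ℝ F Y‖ ≤ L * ‖X - Y‖) (X : symMatrix n) :
    ‖fderiv ℝ F X‖ ≤ ‖fderiv ℝ F 0‖ + L * ‖X‖ := by
  have h1 := hL X 0
  rw [sub_zero] at h1
  linarith [norm_le_norm_add_norm_sub' (fderiv ℝ F X) (fderiv ℝ F 0)]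

theorem norm_fderiv_conjDiag_le (hL0 : 0 ≤ L)
    (hL : ∀ X Y, ‖fderiv ℝ F X - fderiv ℝ F Y‖ ≤ L * ‖X - Y‖) {D r : ℝ}
    {U : Matrix (Fin n) (Fin n) ℝ} (hU : ‖U‖ ≤ r) {l : EuclideanSpace ℝ (Fin n)} (hl : ‖l‖ ≤ D) :
    ‖fderiv ℝ F (conjDiag U l)‖ ≤ ‖fderiv ℝ F 0‖ + L * (r ^ 2 * D) := by
  refine (norm_fderiv_le_of_lipschitz hL _).trans ?_
  have := norm_conjDiag_le U l
  gcongr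
  exact this.trans (by gcongr)

theorem norm_conjDiag_sub_le_of_le {D r : ℝ} {U V : Matrix (Fin n) (Fin n) ℝ} (hU : ‖U‖ ≤ r)
    (hV : ‖V‖ ≤ r) {l : EuclideanSpace ℝ (Fin n)} (hl : ‖l‖ ≤ D) :
    ‖conjDiag U l - conjDiag V l‖ ≤ 2 * r * D * ‖U - V‖ := by
  have hr : 0 ≤ r := (norm_nonneg U).trans hU
  refine (norm_conjDiag_sub_le U V l).trans ?_
  gcongr
  linarith

theorem norm_fderiv_spectralObjective_right_sub_le (hF : Differentiable ℝ F) (hL0 : 0 ≤ L)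
    (hL : ∀ X Y, ‖fderiv ℝ F X - fderiv ℝ F Y‖ ≤ L * ‖X - Y‖) {Q : Matrix (Fin n) (Fin n) ℝ}
    (hQ : Q ∈ orthogonalMatrices n) (l m : EuclideanSpace ℝ (Fin n)) :
    ‖fderiv ℝ (spectralObjective F Q) l - fderiv ℝ (spectralObjective F Q) m‖ ≤ L * ‖l - m‖ := by
  rw [(hasFDerivAt_spectralObjective_right hF Q l).fderiv,
    (hasFDerivAt_spectralObjective_right hF Q m).fderiv, ← ContinuousLinearMap.sub_comp]
  have h1 : ‖conjDiag Q l - conjDiag Q m‖ ≤ ‖l - m‖ := by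
    have := (conjDiagCLM Q).le_of_opNorm_le (norm_conjDiagCLM_le_one hQ) (l - m)
    rwa [map_sub, one_mul] at this
  refine (ContinuousLinearMap.opNorm_comp_le _ _).trans
    ((mul_le_of_le_one_right (norm_nonneg _) (norm_conjDiagCLM_le_one hQ)).trans
      ((hL _ _).trans ?_))
  gcongr

theorem norm_fderiv_spectralObjective_right_sub_le_left (hF : Differentiable ℝ F) (hL0 : 0 ≤ L)
    (hL : ∀ X Y, ‖fderiv ℝ F X - fderiv ℝ F Y‖ ≤ L * ‖X - Y‖) {D : ℝ}
    {P Q : Matrix (Fin n) (Fin n) ℝ} (hP : P ∈ orthogonalMatrices n)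
    (hQ : Q ∈ orthogonalMatrices n) {l : EuclideanSpace ℝ (Fin n)} (hl : ‖l‖ ≤ D) :
    ‖fderiv ℝ (spectralObjective F P) l - fderiv ℝ (spectralObjective F Q) l‖ ≤
      (L * (2 * √n * D) + (‖fderiv ℝ F 0‖ + L * (√n ^ 2 * D)) * (2 * √n)) * ‖P - Q‖ := by
  have hP' := norm_of_mem_orthogonalMatrices hP
  have hQ' := norm_of_mem_orthogonalMatrices hQ
  have hD : 0 ≤ D := (norm_nonneg l).trans hl
  rw [(hasFDerivAt_spectralObjective_right hF P l).fderiv,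
    (hasFDerivAt_spectralObjective_right hF Q l).fderiv]
  have h1 := (hL (conjDiag P l) (conjDiag Q l)).trans
    (mul_le_mul_of_nonneg_left (norm_conjDiag_sub_le_of_le hP'.le hQ'.le hl) hL0)
  have h2 := norm_conjDiagCLM_sub_le P Q
  rw [hP', hQ', ← two_mul] at h2
  calc _ ≤ _ := norm_comp_sub_comp_le _ _ _ _
    _ ≤ L * (2 * √n * D * ‖P - Q‖) * 1 +
        (‖fderiv ℝ F 0‖ + L * (√n ^ 2 * D)) * (2 * √n * ‖P - Q‖) := by
      gcongr
      · exact norm_conjDiagCLM_le_one hP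
      · exact norm_fderiv_conjDiag_le hL0 hL hQ'.le hl
    _ = _ := by ring

theorem norm_fderiv_spectralObjective_left_le (hF : Differentiable ℝ F) (hL0 : 0 ≤ L)
    (hL : ∀ X Y, ‖fderiv ℝ F X - fderiv ℝ F Y‖ ≤ L * ‖X - Y‖) {D r : ℝ}
    {U : Matrix (Fin n) (Fin n) ℝ} (hU : ‖U‖ ≤ r) {l : EuclideanSpace ℝ (Fin n)} (hl : ‖l‖ ≤ D) :
    ‖fderiv ℝ (fun W => spectralObjective F W l) U‖ ≤
      (‖fderiv ℝ F 0‖ + L * (r ^ 2 * D)) * (2 * D * r) := by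
  have hD : 0 ≤ D := (norm_nonneg l).trans hl
  rw [(hasFDerivAt_spectralObjective_left hF U l).fderiv]
  refine (ContinuousLinearMap.opNorm_comp_le _ _).trans ?_
  gcongr
  · exact norm_fderiv_conjDiag_le hL0 hL hU hl
  · exact (norm_conjDiagPolar_le l U).trans (by gcongr)

/-- The first summand of the constant accounts for the moving base point of `DF`, the second for the
moving inner derivative, which is linear in `U`. -/
theorem norm_fderiv_spectralObjective_left_sub_le (hF : Differentiable ℝ F) (hL0 : 0 ≤ L)
    (hL : ∀ X Y, ‖fderiv ℝ F X - fderiv ℝ F Y‖ ≤ L * ‖X - Y‖) {D r : ℝ}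
    {U V : Matrix (Fin n) (Fin n) ℝ} (hU : ‖U‖ ≤ r) (hV : ‖V‖ ≤ r)
    {l : EuclideanSpace ℝ (Fin n)} (hl : ‖l‖ ≤ D) :
    ‖fderiv ℝ (fun W => spectralObjective F W l) U -
        fderiv ℝ (fun W => spectralObjective F W l) V‖ ≤
      (L * (2 * r * D) * (2 * D * r) + (‖fderiv ℝ F 0‖ + L * (r ^ 2 * D)) * (2 * D)) *
        ‖U - V‖ := by
  have hD : 0 ≤ D := (norm_nonneg l).trans hl
  have hr : 0 ≤ r := (norm_nonneg U).trans hU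
  rw [(hasFDerivAt_spectralObjective_left hF U l).fderiv,
    (hasFDerivAt_spectralObjective_left hF V l).fderiv]
  have h1 := (hL (conjDiag U l) (conjDiag V l)).trans
    (mul_le_mul_of_nonneg_left (norm_conjDiag_sub_le_of_le hU hV hl) hL0)
  have h2 : ‖conjDiagPolar l U - conjDiagPolar l V‖ ≤ 2 * D * ‖U - V‖ :=
    (norm_conjDiagPolar_sub_le l U V).trans (by gcongr)
  calc _ ≤ _ := norm_comp_sub_comp_le _ _ _ _
    _ ≤ L * (2 * r * D * ‖U - V‖) * (2 * D * r) +
        (‖fderiv ℝ F 0‖ + L * (r ^ 2 * D)) * (2 * D * ‖U - V‖) := by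
      gcongr
      · exact (norm_conjDiagPolar_le l U).trans (by gcongr)
      · exact norm_fderiv_conjDiag_le hL0 hL hV hl
    _ = _ := by ring

theorem norm_gradient_spectralObjective_right_sub_le (hF : Differentiable ℝ F) (hL0 : 0 ≤ L)
    (hL : ∀ X Y, ‖fderiv ℝ F X - fderiv ℝ F Y‖ ≤ L * ‖X - Y‖) {Q : Matrix (Fin n) (Fin n) ℝ}
    (hQ : Q ∈ orthogonalMatrices n) (l m : EuclideanSpace ℝ (Fin n)) :
    ‖∇ (spectralObjective F Q) l - ∇ (spectralObjective F Q) m‖ ≤ √n * L * ‖l - m‖ := by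
  -- The constant `L` already suffices and `√n ≥ 1` is slack, except for `n = 0`, where `√n = 0` but
  -- the space of `l` is trivial.
  rcases Nat.eq_zero_or_pos n with rfl | hn
  · have : l = m := Subsingleton.elim l m
    simp [this]
  · have h1 : 1 ≤ √(n : ℝ) := Real.one_le_sqrt.2 (by exact_mod_cast hn)
    rw [norm_gradient_sub, mul_assoc]
    exact (norm_fderiv_spectralObjective_right_sub_le hF hL0 hL hQ l m).trans
      (le_mul_of_one_le_left (by positivity) h1)

theorem lipschitzConditions_spectralObjective (hF : Differentiable ℝ F) (hL0 : 0 ≤ L)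
    (hL : ∀ X Y, ‖fderiv ℝ F X - fderiv ℝ F Y‖ ≤ L * ‖X - Y‖)
    {C : Set (EuclideanSpace ℝ (Fin n))} {D : ℝ} (hD : 0 ≤ D) (hC : ∀ l ∈ C, ‖l‖ ≤ D)
    {R : Matrix (Fin n) (Fin n) ℝ → Matrix (Fin n) (Fin n) ℝ → Matrix (Fin n) (Fin n) ℝ}
    (hR : IsRetraction (orthogonalMatrices n) R) :
    LipschitzConditions (orthogonalMatrices n) C R (spectralObjective F) where
  differentiable Q _ l _ := (hasFDerivAt_spectralObjective_right hF Q l).differentiableAt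
  grad_y := ⟨√n * L, by positivity, fun Q hQ l _ m _ =>
    norm_gradient_spectralObjective_right_sub_le hF hL0 hL hQ l m⟩
  grad_x := by
    have hB : ∀ Q ∈ orthogonalMatrices n, ‖Q‖ ≤ √n := fun Q hQ =>
      (norm_of_mem_orthogonalMatrices hQ).le
    have hK : 0 ≤ L * (2 * √n * D) * (2 * D * √n) +
        (‖fderiv ℝ F 0‖ + L * (√n ^ 2 * D)) * (2 * D) := by positivity
    have hN : 0 ≤ (‖fderiv ℝ F 0‖ + L * (√n ^ 2 * D)) * (2 * D * √n) := by positivity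
    obtain ⟨L₁, h₁⟩ := isRetraction_riemannianExp.exists_hasGradLipRetraction
      isCompact_orthogonalMatrices hB hK hN
    obtain ⟨L₂, h₂⟩ := hR.exists_hasGradLipRetraction isCompact_orthogonalMatrices hB hK hN
    -- `L₁` serves the exponential map and `L₂` serves `R`. Both are fixed before `l`, since they
    -- depend on the function only through its bounds.
    refine ⟨max 1 (max L₁ L₂), le_max_left _ _, fun l hl => ?_⟩
    have hd : Differentiable ℝ (fun W => spectralObjective F W l) := fun U =>
      (hasFDerivAt_spectralObjective_left hF U l).differentiableAt
    have hlip : ∀ U ∈ Metric.closedBall (0 : Matrix (Fin n) (Fin n) ℝ) √n,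
        ∀ V ∈ Metric.closedBall (0 : Matrix (Fin n) (Fin n) ℝ) √n, _ := fun U hU V hV =>
      norm_fderiv_spectralObjective_left_sub_le hF hL0 hL (mem_closedBall_zero_iff.1 hU)
        (mem_closedBall_zero_iff.1 hV) (hC l hl)
    have hbd : ∀ Q ∈ orthogonalMatrices n, _ := fun Q hQ =>
      norm_fderiv_spectralObjective_left_le hF hL0 hL (hB Q hQ) (hC l hl)
    have hgrad : ∀ Q ∈ orthogonalMatrices n, _ := fun Q hQ =>
      exists_tangent_representative hQ (fderiv ℝ (fun W => spectralObjective F W l) Q)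
    exact ⟨h₁ _ hd hlip hbd hgrad _ ((le_max_left _ _).trans (le_max_right _ _)),
      h₂ _ hd hlip hbd hgrad _ ((le_max_right _ _).trans (le_max_right _ _))⟩
  grad_xy := ⟨L * (2 * √n * D) + (‖fderiv ℝ F 0‖ + L * (√n ^ 2 * D)) * (2 * √n), by positivity,
    fun P hP Q hQ l hl => by
      rw [norm_gradient_sub]
      exact norm_fderiv_spectralObjective_right_sub_le_left hF hL0 hL hP hQ (hC l hl)⟩

theorem exists_lipschitz_gradient_spectralObjective_left (hF : Differentiable ℝ F) (hL0 : 0 ≤ L)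
    (hL : ∀ X Y, ‖fderiv ℝ F X - fderiv ℝ F Y‖ ≤ L * ‖X - Y‖)
    {C : Set (EuclideanSpace ℝ (Fin n))} {D : ℝ} (hD : 0 ≤ D) (hC : ∀ l ∈ C, ‖l‖ ≤ D) :
    ∃ K : ℝ, 0 ≤ K ∧ ∀ l ∈ C, Differentiable ℝ (fun U => spectralObjective F U l) ∧
      ∀ U ∈ convexHull ℝ (orthogonalMatrices n), ∀ V ∈ convexHull ℝ (orthogonalMatrices n),
        ‖∇ (fun W => spectralObjective F W l) U - ∇ (fun W => spectralObjective F W l) V‖ ≤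
          K * ‖U - V‖ := by
  refine ⟨L * (2 * √n * D) * (2 * D * √n) + (‖fderiv ℝ F 0‖ + L * (√n ^ 2 * D)) * (2 * D),
    by positivity, fun l hl => ⟨fun U =>
      (hasFDerivAt_spectralObjective_left hF U l).differentiableAt, fun U hU V hV => ?_⟩⟩
  rw [norm_gradient_sub]
  exact norm_fderiv_spectralObjective_left_sub_le hF hL0 hL
    (mem_closedBall_zero_iff.1 (convexHull_orthogonalMatrices_subset hU))
    (mem_closedBall_zero_iff.1 (convexHull_orthogonalMatrices_subset hV)) (hC l hl)

theorem norm_fderiv_sub_le_of_gradient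
    (hL : ∀ X Y : symMatrix n, ‖∇ F X - ∇ F Y‖ ≤ L * ‖X - Y‖) (X Y : symMatrix n) :
    ‖fderiv ℝ F X - fderiv ℝ F Y‖ ≤ L * ‖X - Y‖ :=
  (norm_gradient_sub F F X Y).symm.trans_le (hL X Y)

end Objective

end SpectralLip

theorem mainTheorem4 (n : ℕ) (F : SpectralLip.symMatrix n → ℝ) (L_F : ℝ) (hL_F : 0 < L_F)
    (hF : Differentiable ℝ F)
    (hF_lip : ∀ X₁ X₂ : SpectralLip.symMatrix n, ‖∇ F X₁ - ∇ F X₂‖ ≤ L_F * ‖X₁ - X₂‖)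
    (C : Set (EuclideanSpace ℝ (Fin n))) (D : ℝ) (hC : ∀ l ∈ C, ‖l‖ ≤ D) :
    (∀ R : Matrix (Fin n) (Fin n) ℝ → Matrix (Fin n) (Fin n) ℝ → Matrix (Fin n) (Fin n) ℝ,
      SpectralLip.IsRetraction (SpectralLip.orthogonalMatrices n) R →
      SpectralLip.LipschitzConditions (SpectralLip.orthogonalMatrices n) C R
        (SpectralLip.spectralObjective F)) ∧
    (∀ Q ∈ SpectralLip.orthogonalMatrices n,
      Differentiable ℝ (SpectralLip.spectralObjective F Q) ∧
      ∀ l₁ l₂ : EuclideanSpace ℝ (Fin n),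
        ‖∇ (SpectralLip.spectralObjective F Q) l₁ - ∇ (SpectralLip.spectralObjective F Q) l₂‖
          ≤ Real.sqrt n * L_F * ‖l₁ - l₂‖) ∧
    (∃ L_G : ℝ, 0 ≤ L_G ∧ ∀ l ∈ C,
      Differentiable ℝ (fun U => SpectralLip.spectralObjective F U l) ∧
      ∀ U ∈ convexHull ℝ (SpectralLip.orthogonalMatrices n),
      ∀ V ∈ convexHull ℝ (SpectralLip.orthogonalMatrices n),
        ‖∇ (fun W => SpectralLip.spectralObjective F W l) U
            - ∇ (fun W => SpectralLip.spectralObjective F W l) V‖ ≤ L_G * ‖U - V‖) := by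
  have hlip := SpectralLip.norm_fderiv_sub_le_of_gradient hF_lip
  -- `D` may be negative when `C` is empty; the constants need a nonnegative radius.
  have hC' : ∀ l ∈ C, ‖l‖ ≤ max D 0 := fun l hl => (hC l hl).trans (le_max_left _ _)
  refine ⟨fun R hR => SpectralLip.lipschitzConditions_spectralObjective hF hL_F.le hlip
      (le_max_right D 0) hC' hR, fun Q hQ => ⟨fun l =>
      (SpectralLip.hasFDerivAt_spectralObjective_right hF Q l).differentiableAt,
      SpectralLip.norm_gradient_spectralObjective_right_sub_le hF hL_F.le hlip hQ⟩,
    SpectralLip.exists_lipschitz_gradient_spectralObjective_left hF hL_F.le hlip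
      (le_max_right D 0) hC'⟩
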